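/- Let $d \ge 3$ and let $\mathbb{T}^d = \mathbb{R}^d/\mathbb{Z}^d$ be the standard flat $d$-torus. For a real-valued function $\psi$ on $\mathbb{T}^d$ write $\psi_+ = \psi\,\chi_{\{\psi>0\}}$ and $\psi_- = -\psi\,\chi_{\{\psi<0\}}$. Then there exists a sequence $(\psi_n)$ of nonconstant real-valued smooth eigenfunctions of the Laplacian on $\mathbb{T}^d$, $-\Delta\psi_n = \lambda_n\psi_n$, with eigenvalues $\lambda_n > 0$ and $\lambda_n \to \infty$ as $n\to\infty$, such that for every $p$ with $1 < p \le \infty$, $$\frac{\|\psi_{n,+}\|_p}{\|\psi_{n,-}\|_p} \not\to 1 \qquad\text{as } n\to\infty,$$ where $\|\cdot\|_p$ denotes the $L^p(\mathbb{T}^d)$ norm. -/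

import Mathlib

open MeasureTheory Filter
open scoped ContDiff ENNReal

/-- The periodic lift to Euclidean space `ℝ^d` of a function on the standard flat torus
`𝕋^d = ℝ^d / ℤ^d`, that is, its composition with the quotient map. Since the quotient map is a
local isometry, smoothness and the Laplacian on `𝕋^d` are those of the lift. -/
def torusLift {d : ℕ} (f : UnitAddTorus (Fin d) → ℝ) : EuclideanSpace ℝ (Fin d) → ℝ :=
  fun x => f (fun i => (x i : UnitAddCircle))

/-- `f` is a (real, smooth, nonzero) eigenfunction of the Laplacian on the standard flat torus
`𝕋^d`, with eigenvalue `lam`, in the convention `-Δ f = lam * f`. -/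
structure IsLaplaceEigenfunction {d : ℕ} (f : UnitAddTorus (Fin d) → ℝ) (lam : ℝ) : Prop where
  smooth : ContDiff ℝ ∞ (torusLift f)
  ne_zero : f ≠ 0
  eigen : ∀ x, -(Laplacian.laplacian (torusLift f) x) = lam * torusLift f x

/-- The positive part `f₊ = f · χ_{f > 0}`. -/
noncomputable def positivePart {X : Type*} (f : X → ℝ) : X → ℝ :=
  Set.indicator {x | 0 < f x} f

/-- The negative part `f₋ = -f · χ_{f < 0}`; it is nonnegative. -/
noncomputable def negativePart {X : Type*} (f : X → ℝ) : X → ℝ :=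
  Set.indicator {x | f x < 0} (-f)

/-- The ratio `‖f₊‖_p / ‖f₋‖_p` of `L^p` norms over the torus, for the Riemannian (Haar)
measure. It takes values in `[0, ∞]`. -/
noncomputable def signRatio {d : ℕ} (f : UnitAddTorus (Fin d) → ℝ) (p : ℝ≥0∞) : ℝ≥0∞ :=
  eLpNorm (positivePart f) p volume / eLpNorm (negativePart f) p volume

/-! Put f = `hexWave i j k`, u = π(x_i - x_j) and v = π(x_i + x_j - 2x_k). Then f = 2 cos v cos u +
cos 2u, which has maximum 3 but minimum at least -3/2, so p = ∞ is clear. For finite p it suffices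
that ∫ Φ(f) > 0 with Φ(t) = sign(t)|t|^p, since this integral is ‖f₊‖_p^p - ‖f₋‖_p^p. Average over
the four translates u ↦ u + nπ/2 with v fixed: by convexity of t^p the sum of Φ over them is
nonnegative (`oddPow_four_term_nonneg`), and at the origin it is 3^p - 3 > 0. The three frequencies
have equal length, so f is an eigenfunction. The dilates f(nx) have eigenvalues tending to infinity
and the same sign ratio as f, which is not 1. -/

section OddPower

/-- The odd extension `t ↦ sign t * |t| ^ p` of the power function. -/
noncomputable def oddPow (p t : ℝ) : ℝ := max t 0 ^ p - max (-t) 0 ^ p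

lemma oddPow_of_nonneg {p t : ℝ} (hp : 0 < p) (ht : 0 ≤ t) : oddPow p t = t ^ p := by
  simp [oddPow, ht, Real.zero_rpow hp.ne']

lemma oddPow_neg (p t : ℝ) : oddPow p (-t) = -oddPow p t := by
  simp [oddPow]

lemma continuous_oddPow {p : ℝ} (hp : 0 < p) : Continuous (oddPow p) := by
  unfold oddPow
  exact ((continuous_id.max continuous_const).rpow_const fun _ => Or.inr hp.le).sub
    ((continuous_neg.max continuous_const).rpow_const fun _ => Or.inr hp.le)

/-- Both y and x + h are convex combinations of x and y + h, with the weights swapped; add the two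
convexity inequalities. -/
lemma ConvexOn.add_le_add_of_le {g : ℝ → ℝ} {s : Set ℝ} (hg : ConvexOn ℝ s g) {x y h : ℝ}
    (hx : x ∈ s) (hy : y + h ∈ s) (hxy : x ≤ y) (hh : 0 ≤ h) :
    g (x + h) + g y ≤ g (y + h) + g x := by
  rcases hh.eq_or_lt with rfl | hh
  · simp [add_comm]
  have hD : 0 < y + h - x := by linarith
  have hw : h / (y + h - x) + (y - x) / (y + h - x) = 1 := by field_simp; ring
  have h0 : 0 ≤ h / (y + h - x) := by positivity
  have h1 : 0 ≤ (y - x) / (y + h - x) := div_nonneg (by linarith) hD.le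
  have e1 := hg.2 hx hy h0 h1 hw
  have e2 := hg.2 hx hy h1 h0 (by rw [add_comm, hw])
  have k1 : h / (y + h - x) * x + (y - x) / (y + h - x) * (y + h) = y := by field_simp; ring
  have k2 : (y - x) / (y + h - x) * x + h / (y + h - x) * (y + h) = x + h := by
    field_simp; ring
  simp only [smul_eq_mul] at e1 e2
  rw [k1] at e1
  rw [k2] at e2
  calc g (x + h) + g y
      ≤ (h / (y + h - x) + (y - x) / (y + h - x)) * (g (y + h) + g x) := by linarith
    _ = g (y + h) + g x := by rw [hw, one_mul]

lemma oddPow_add_oddPow_sub_mono {p q r s : ℝ} (hp : 1 ≤ p) (hq : 0 ≤ q) (hr : 0 ≤ r)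
    (hrs : r ≤ s) :
    oddPow p (q + r) + oddPow p (q - r) ≤ oddPow p (q + s) + oddPow p (q - s) := by
  have hp0 : 0 < p := by linarith
  have inner : ∀ r s : ℝ, 0 ≤ r → r ≤ s → s ≤ q →
      oddPow p (q + r) + oddPow p (q - r) ≤ oddPow p (q + s) + oddPow p (q - s) := by
    intro r s hr hrs hsq
    have := (convexOn_rpow hp).add_le_add_of_le (x := q - s) (y := q + r) (h := s - r)
      (Set.mem_Ici.2 (by linarith)) (Set.mem_Ici.2 (by linarith)) (by linarith) (by linarith)
    rw [show q - s + (s - r) = q - r by ring, show q + r + (s - r) = q + s by ring] at this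
    rw [oddPow_of_nonneg hp0 (by linarith), oddPow_of_nonneg hp0 (by linarith),
      oddPow_of_nonneg hp0 (by linarith), oddPow_of_nonneg hp0 (by linarith)]
    linarith
  -- Here q - r ≤ 0, so by oddness the sum is (q + r)^p - (r - q)^p, an increment of t^p of fixed
  -- length 2q, which grows with r.
  have outer : ∀ r s : ℝ, r ≤ s → q ≤ r →
      oddPow p (q + r) + oddPow p (q - r) ≤ oddPow p (q + s) + oddPow p (q - s) := by
    intro r s hrs hqr
    have := (convexOn_rpow hp).add_le_add_of_le (x := r - q) (y := s - q) (h := 2 * q)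
      (Set.mem_Ici.2 (by linarith)) (Set.mem_Ici.2 (by linarith)) (by linarith) (by linarith)
    rw [show r - q + 2 * q = q + r by ring, show s - q + 2 * q = q + s by ring] at this
    rw [← neg_sub r q, ← neg_sub s q, oddPow_neg, oddPow_neg,
      oddPow_of_nonneg hp0 (by linarith), oddPow_of_nonneg hp0 (by linarith),
      oddPow_of_nonneg hp0 (by linarith), oddPow_of_nonneg hp0 (by linarith)]
    linarith
  rcases le_total s q with h | h
  · exact inner r s hr hrs h
  · rcases le_total r q with h' | h'
    · exact (inner r q hr h' le_rfl).trans (outer q s h le_rfl)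
    · exact outer r s hrs h'

lemma oddPow_add_oddPow_sub_abs (p q s : ℝ) :
    oddPow p (q + |s|) + oddPow p (q - |s|) = oddPow p (q + s) + oddPow p (q - s) := by
  rcases abs_choice s with h | h <;> rw [h]
  rw [sub_neg_eq_add, ← sub_eq_add_neg, add_comm]

/-- With q = a² - b² ≥ 0, oddness turns the sum into S(ca) - S(cb), where S(s) = Φ(q + s) + Φ(q - s)
is even and nondecreasing in |s|. Exchanging a and b covers q ≤ 0. -/
lemma oddPow_four_term_nonneg {p : ℝ} (hp : 1 ≤ p) (c a b : ℝ) :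
    0 ≤ oddPow p (c * a + (a ^ 2 - b ^ 2)) + oddPow p (-(c * b) - (a ^ 2 - b ^ 2))
      + oddPow p (-(c * a) + (a ^ 2 - b ^ 2)) + oddPow p (c * b - (a ^ 2 - b ^ 2)) := by
  have key : ∀ a b : ℝ, |b| ≤ |a| →
      0 ≤ oddPow p (c * a + (a ^ 2 - b ^ 2)) + oddPow p (-(c * b) - (a ^ 2 - b ^ 2))
      + oddPow p (-(c * a) + (a ^ 2 - b ^ 2)) + oddPow p (c * b - (a ^ 2 - b ^ 2)) := by
    intro a b hab
    have hq : 0 ≤ a ^ 2 - b ^ 2 := sub_nonneg.2 (sq_le_sq.2 hab)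
    have := oddPow_add_oddPow_sub_mono (r := |c * b|) (s := |c * a|) hp hq (abs_nonneg _)
      (by rw [abs_mul, abs_mul]; gcongr)
    rw [oddPow_add_oddPow_sub_abs, oddPow_add_oddPow_sub_abs] at this
    have e1 := oddPow_neg p (a ^ 2 - b ^ 2 + c * b)
    have e2 := oddPow_neg p (a ^ 2 - b ^ 2 - c * b)
    rw [show -(c * b) - (a ^ 2 - b ^ 2) = -(a ^ 2 - b ^ 2 + c * b) by ring,
      show c * b - (a ^ 2 - b ^ 2) = -(a ^ 2 - b ^ 2 - c * b) by ring, e1, e2,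
      add_comm (c * a), neg_add_eq_sub]
    linarith
  rcases le_total |b| |a| with h | h
  · exact key a b h
  · have := key b a h
    rw [show c * b + (b ^ 2 - a ^ 2) = c * b - (a ^ 2 - b ^ 2) by ring,
      show -(c * a) - (b ^ 2 - a ^ 2) = -(c * a) + (a ^ 2 - b ^ 2) by ring,
      show -(c * b) + (b ^ 2 - a ^ 2) = -(c * b) - (a ^ 2 - b ^ 2) by ring,
      show c * a - (b ^ 2 - a ^ 2) = c * a + (a ^ 2 - b ^ 2) by ring] at this
    linarith

end OddPower

/-! ### Plane waves as Laplace eigenfunctions. -/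

section PlaneWave

lemma contDiff_cos_inner {E : Type*} [NormedAddCommGroup E] [InnerProductSpace ℝ E]
    (ξ : E) {n : WithTop ℕ∞} : ContDiff ℝ n (fun x : E => Real.cos (inner ℝ ξ x)) :=
  Real.contDiff_cos.comp (innerSL ℝ ξ).contDiff

lemma laplacian_cos_inner {E : Type*} [NormedAddCommGroup E] [InnerProductSpace ℝ E]
    [FiniteDimensional ℝ E] (ξ x : E) :
    Laplacian.laplacian (fun x : E => Real.cos (inner ℝ ξ x)) x
      = -(‖ξ‖ ^ 2 * Real.cos (inner ℝ ξ x)) := by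
  rw [InnerProductSpace.laplacian_eq_iteratedFDeriv_stdOrthonormalBasis]
  have h := (innerSL ℝ ξ).iteratedFDeriv_comp_right (f := Real.cos) (n := 2)
    Real.contDiff_cos x (i := 2) le_rfl
  have hc : (Real.cos ∘ (innerSL ℝ ξ)) = fun x : E => Real.cos (inner ℝ ξ x) := rfl
  rw [hc] at h
  have h2 : iteratedDeriv 2 Real.cos = fun t => -Real.cos t := by
    rw [iteratedDeriv_succ, iteratedDeriv_one, Real.deriv_cos']
    ext t
    simp
  simp only [h, ContinuousMultilinearMap.compContinuousLinearMap_apply,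
    iteratedFDeriv_apply_eq_iteratedDeriv_mul_prod, h2, Fin.prod_univ_two, innerSL_apply_apply,
    smul_eq_mul, Matrix.cons_val_zero, Matrix.cons_val_one]
  rw [← Finset.sum_mul, ← (stdOrthonormalBasis ℝ E).sum_sq_inner_left ξ]
  simp only [← pow_two, mul_neg]

end PlaneWave

/-! ### The hexagonal wave, its bounds and its translates. -/

section HexagonalWave

/-- The function `y ↦ cos (2 π y)` on the circle `ℝ / ℤ`. -/
noncomputable def circleCos (y : UnitAddCircle) : ℝ := (AddCircle.toCircle y : ℂ).re

lemma continuous_circleCos : Continuous circleCos :=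
  Complex.continuous_re.comp (continuous_subtype_val.comp AddCircle.continuous_toCircle)

lemma circleCos_coe (t : ℝ) : circleCos (t : UnitAddCircle) = Real.cos (2 * Real.pi * t) := by
  rw [circleCos, AddCircle.toCircle_apply_mk, Circle.coe_exp, Complex.exp_ofReal_mul_I_re, div_one]

/-- The sum of three plane waves whose frequencies `e i - e k`, `e k - e j`, `e i - e j` have equal
length and of which the third is the sum of the others. -/
noncomputable def hexWave {d : ℕ} (i j k : Fin d) (x : UnitAddTorus (Fin d)) : ℝ :=
  circleCos (x i - x k) + circleCos (x k - x j) + circleCos (x i - x j)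

variable {d : ℕ} (i j k : Fin d)

lemma continuous_hexWave : Continuous (hexWave i j k) := by
  have := continuous_circleCos
  unfold hexWave
  fun_prop

lemma hexWave_zero : hexWave i j k 0 = 3 := by
  have : circleCos 0 = 1 := by simpa using circleCos_coe 0
  simp only [hexWave, Pi.zero_apply, sub_zero, this]
  norm_num

lemma hexWave_coe (x : Fin d → ℝ) :
    hexWave i j k (fun m => (x m : UnitAddCircle))
      = 2 * Real.cos (Real.pi * (x i + x j - 2 * x k)) * Real.cos (Real.pi * (x i - x j))
        + (Real.cos (Real.pi * (x i - x j)) ^ 2 - Real.sin (Real.pi * (x i - x j)) ^ 2) := by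
  simp only [hexWave, ← AddCircle.coe_sub, circleCos_coe]
  rw [← Real.cos_two_mul',
    show 2 * Real.pi * (x i - x k)
      = Real.pi * (x i + x j - 2 * x k) + Real.pi * (x i - x j) by ring,
    show 2 * Real.pi * (x k - x j)
      = Real.pi * (x i - x j) - Real.pi * (x i + x j - 2 * x k) by ring,
    Real.cos_add, Real.cos_sub, mul_assoc 2 Real.pi]
  ring

lemma exists_torus_lift (y : UnitAddTorus (Fin d)) :
    ∃ x : Fin d → ℝ, (fun m => (x m : UnitAddCircle)) = y := by
  choose x hx using fun m => QuotientAddGroup.mk_surjective (y m)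
  exact ⟨x, funext hx⟩

lemma neg_three_halves_le_hexWave (y : UnitAddTorus (Fin d)) : -(3 / 2) ≤ hexWave i j k y := by
  obtain ⟨x, rfl⟩ := exists_torus_lift y
  rw [hexWave_coe, Real.sin_sq]
  set c := Real.cos (Real.pi * (x i + x j - 2 * x k))
  set a := Real.cos (Real.pi * (x i - x j))
  have hc : c ^ 2 ≤ 1 := Real.cos_sq_le_one _
  -- Complete the square: 2ca + 2a² - 1 = (2a + c)²/2 - c²/2 - 1.
  nlinarith [sq_nonneg (2 * a + c)]

/-- The quarter period shift of `hexWave`. -/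
noncomputable def quarterShift : UnitAddTorus (Fin d) :=
  fun m => ((Pi.single i (1 / 4) - Pi.single j (1 / 4) : Fin d → ℝ) m : UnitAddCircle)

/-- The shift moves x_i and x_j by opposite amounts and fixes x_k, so only the phase u changes. -/
lemma hexWave_add_nsmul_quarterShift (hij : i ≠ j) (hik : i ≠ k) (hjk : j ≠ k) (n : ℕ)
    (x : Fin d → ℝ) :
    hexWave i j k ((fun m => (x m : UnitAddCircle)) + n • quarterShift i j)
      = 2 * Real.cos (Real.pi * (x i + x j - 2 * x k))
          * Real.cos (Real.pi * (x i - x j) + n * (Real.pi / 2))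
        + (Real.cos (Real.pi * (x i - x j) + n * (Real.pi / 2)) ^ 2
          - Real.sin (Real.pi * (x i - x j) + n * (Real.pi / 2)) ^ 2) := by
  have h : (fun m => (x m : UnitAddCircle)) + n • quarterShift i j
      = fun m => ((x + n • (Pi.single i (1 / 4) - Pi.single j (1 / 4) : Fin d → ℝ)) m :
        UnitAddCircle) := by
    ext m
    simp only [quarterShift, Pi.add_apply, Pi.smul_apply, AddCircle.coe_add, AddCircle.coe_nsmul]
  rw [h, hexWave_coe]
  simp only [Pi.add_apply, Pi.smul_apply, Pi.sub_apply, Pi.single_eq_same,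
    Pi.single_eq_of_ne hij, Pi.single_eq_of_ne hij.symm, Pi.single_eq_of_ne hik.symm,
    Pi.single_eq_of_ne hjk.symm]
  simp only [nsmul_eq_mul]
  ring_nf

lemma sum_oddPow_hexWave_shift (hij : i ≠ j) (hik : i ≠ k) (hjk : j ≠ k) (p : ℝ)
    (x : Fin d → ℝ) :
    ∑ n ∈ Finset.range 4,
        oddPow p (hexWave i j k ((fun m => (x m : UnitAddCircle)) + n • quarterShift i j))
      = let c := 2 * Real.cos (Real.pi * (x i + x j - 2 * x k))
        let a := Real.cos (Real.pi * (x i - x j))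
        let b := Real.sin (Real.pi * (x i - x j))
        oddPow p (c * a + (a ^ 2 - b ^ 2)) + oddPow p (-(c * b) - (a ^ 2 - b ^ 2))
          + oddPow p (-(c * a) + (a ^ 2 - b ^ 2)) + oddPow p (c * b - (a ^ 2 - b ^ 2)) := by
  simp only [hexWave_add_nsmul_quarterShift i j k hij hik hjk, Finset.sum_range_succ,
    Finset.sum_range_zero, zero_add]
  set c := 2 * Real.cos (Real.pi * (x i + x j - 2 * x k))
  set u := Real.pi * (x i - x j)
  have e2 : u + (2 : ℕ) * (Real.pi / 2) = u + Real.pi := by push_cast; ring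
  have e3 : u + (3 : ℕ) * (Real.pi / 2) = u + Real.pi / 2 + Real.pi := by push_cast; ring
  simp only [e2, e3, Nat.cast_zero, zero_mul, add_zero, Nat.cast_one, one_mul, Real.cos_add_pi,
    Real.sin_add_pi, Real.cos_add_pi_div_two, Real.sin_add_pi_div_two]
  ring_nf

lemma integral_oddPow_hexWave_pos (hij : i ≠ j) (hik : i ≠ k) (hjk : j ≠ k) {p : ℝ}
    (hp : 1 < p) : 0 < ∫ y, oddPow p (hexWave i j k y) := by
  have hcont : Continuous fun y => oddPow p (hexWave i j k y) :=
    (continuous_oddPow (by linarith)).comp (continuous_hexWave i j k)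
  have hshift : ∀ n : ℕ, Continuous fun y : UnitAddTorus (Fin d) =>
      oddPow p (hexWave i j k (y + n • quarterShift i j)) := fun n =>
    hcont.comp (continuous_id.add continuous_const)
  have hsum : ∫ y, ∑ n ∈ Finset.range 4, oddPow p (hexWave i j k (y + n • quarterShift i j))
      = 4 * ∫ y, oddPow p (hexWave i j k y) := by
    rw [integral_finsetSum _ fun n _ =>
      (hshift n).integrable_of_hasCompactSupport (HasCompactSupport.of_compactSpace _)]
    simp only [fun t : UnitAddTorus (Fin d) =>
      integral_add_right_eq_self (μ := volume) (fun y => oddPow p (hexWave i j k y)) t]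
    simp
  have hpos : 0 < ∫ y, ∑ n ∈ Finset.range 4,
      oddPow p (hexWave i j k (y + n • quarterShift i j)) := by
    refine Continuous.integral_pos_of_hasCompactSupport_nonneg_nonzero (x := 0)
      (continuous_finsetSum _ fun n _ => hshift n) (HasCompactSupport.of_compactSpace _)
      (fun y => ?_) ?_
    · obtain ⟨x, rfl⟩ := exists_torus_lift y
      dsimp only [Pi.zero_apply]
      rw [sum_oddPow_hexWave_shift i j k hij hik hjk]
      exact oddPow_four_term_nonneg hp.le _ _ _
    -- At the origin the four translates take the values 3, -1, -1, -1, so the sum is 3^p - 3;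
    -- strictness needs p > 1.
    · have h := sum_oddPow_hexWave_shift i j k hij hik hjk p 0
      have h0 : (fun m => ((0 : Fin d → ℝ) m : UnitAddCircle)) = 0 := rfl
      rw [h0] at h
      rw [h]
      have h1 : oddPow p (-1) = -1 := by
        rw [oddPow_neg, oddPow_of_nonneg (by linarith) zero_le_one, Real.one_rpow]
      have h3 : oddPow p 3 = 3 ^ p := oddPow_of_nonneg (by linarith) (by norm_num)
      have hlt : (3 : ℝ) ^ (1 : ℝ) < 3 ^ p := Real.rpow_lt_rpow_of_exponent_lt (by norm_num) hp
      norm_num [h1, h3] at hlt ⊢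
      linarith
  linarith

/-! ### The sign ratio and its invariance under dilation. -/

lemma positivePart_eq_max {X : Type*} (f : X → ℝ) : positivePart f = fun x => max (f x) 0 := by
  ext x
  by_cases h : 0 < f x
  · rw [positivePart, Set.indicator_of_mem (by exact h), max_eq_left h.le]
  · rw [positivePart, Set.indicator_of_notMem (by exact h), max_eq_right (not_lt.1 h)]

lemma negativePart_eq_max {X : Type*} (f : X → ℝ) : negativePart f = fun x => max (-f x) 0 := by
  ext x
  by_cases h : f x < 0
  · rw [negativePart, Set.indicator_of_mem (by exact h), Pi.neg_apply,
      max_eq_left (by linarith)]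
  · rw [negativePart, Set.indicator_of_notMem (by exact h), max_eq_right (by linarith)]

lemma Continuous.integral_rpow_eq_of_eLpNorm_eq {X : Type*} [TopologicalSpace X] [CompactSpace X]
    [MeasurableSpace X] [OpensMeasurableSpace X] {μ : Measure X} [IsFiniteMeasure μ]
    {f g : X → ℝ} (hf : Continuous f) (hg : Continuous g) (hf0 : 0 ≤ f) (hg0 : 0 ≤ g)
    {p : ℝ≥0∞} (hp0 : p ≠ 0) (hp : p ≠ ⊤) (h : eLpNorm f p μ = eLpNorm g p μ) :
    ∫ x, f x ^ p.toReal ∂μ = ∫ x, g x ^ p.toReal ∂μ := by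
  have hpos := ENNReal.toReal_pos hp0 hp
  rw [(hf.memLp_of_hasCompactSupport (HasCompactSupport.of_compactSpace _)).eLpNorm_eq_integral_rpow_norm
      hp0 hp,
    (hg.memLp_of_hasCompactSupport (HasCompactSupport.of_compactSpace _)).eLpNorm_eq_integral_rpow_norm
      hp0 hp] at h
  simp only [Real.norm_of_nonneg (hf0 _), Real.norm_of_nonneg (hg0 _)] at h
  have hfi : 0 ≤ ∫ x, f x ^ p.toReal ∂μ := integral_nonneg fun x => Real.rpow_nonneg (hf0 x) _
  have hgi : 0 ≤ ∫ x, g x ^ p.toReal ∂μ := integral_nonneg fun x => Real.rpow_nonneg (hg0 x) _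
  rw [ENNReal.ofReal_eq_ofReal_iff (by positivity) (by positivity)] at h
  exact (Real.rpow_left_inj hfi hgi (inv_ne_zero hpos.ne')).1 h

lemma signRatio_hexWave_ne_one (hij : i ≠ j) (hik : i ≠ k) (hjk : j ≠ k) {p : ℝ≥0∞}
    (hp : 1 < p) : signRatio (hexWave i j k) p ≠ 1 := by
  intro h
  have heq : eLpNorm (positivePart (hexWave i j k)) p volume
      = eLpNorm (negativePart (hexWave i j k)) p volume := by
    rw [signRatio] at h
    -- A zero denominator would give the ratio 0 or ∞ (0/0 = 0 by convention), and an infinite one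
    -- the ratio 0.
    refine (ENNReal.div_eq_one_iff ?_ ?_).1 h
    · intro h0
      rw [h0] at h
      by_cases hn : eLpNorm (positivePart (hexWave i j k)) p volume = 0
      · simp [hn] at h
      · simp [ENNReal.div_zero hn] at h
    · intro h0
      simp [h0] at h
  have hcont := continuous_hexWave i j k
  rw [positivePart_eq_max, negativePart_eq_max] at heq
  have hc1 : Continuous fun y => max (hexWave i j k y) 0 := hcont.max continuous_const
  have hc2 : Continuous fun y => max (-hexWave i j k y) 0 := hcont.neg.max continuous_const
  rcases eq_or_ne p ⊤ with rfl | hp'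
  · rw [eLpNorm_exponent_top, eLpNorm_exponent_top] at heq
    have hub : eLpNormEssSup (fun y => max (-hexWave i j k y) 0) volume
        ≤ ENNReal.ofReal (3 / 2) := by
      refine eLpNormEssSup_le_of_ae_bound (Eventually.of_forall fun y => ?_)
      rw [Real.norm_of_nonneg (le_max_right _ _)]
      exact max_le (by linarith [neg_three_halves_le_hexWave i j k y]) (by norm_num)
    rw [← heq] at hub
    have hae : ∀ᵐ y : UnitAddTorus (Fin d), hexWave i j k y ≤ 3 / 2 := by
      filter_upwards [ae_le_eLpNormEssSup (f := fun y => max (hexWave i j k y) 0)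
        (μ := volume)] with y hy
      have hy' := hy.trans hub
      rw [Real.enorm_eq_ofReal (le_max_right _ _),
        ENNReal.ofReal_le_ofReal_iff (by norm_num)] at hy'
      exact (le_max_left _ _).trans hy'
    -- This open set contains the origin, where the value is 3, so it cannot be null.
    have hopen : IsOpen {y | 3 / 2 < hexWave i j k y} := isOpen_lt continuous_const hcont
    have hnull : (volume : Measure (UnitAddTorus (Fin d))) {y | 3 / 2 < hexWave i j k y} = 0 := by
      simpa [ae_iff] using hae
    refine (hopen.measure_pos volume ⟨0, ?_⟩).ne' hnull
    rw [Set.mem_ofPred_eq, hexWave_zero]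
    norm_num
  · have hp1 : 1 < p.toReal := by
      simpa using (ENNReal.toReal_lt_toReal ENNReal.one_ne_top hp').2 hp
    have hint := hc1.integral_rpow_eq_of_eLpNorm_eq hc2 (fun _ => le_max_right _ _)
      (fun _ => le_max_right _ _) (zero_lt_one.trans hp).ne' hp' heq
    have hpos := integral_oddPow_hexWave_pos i j k hij hik hjk hp1
    simp only [oddPow] at hpos
    have hi1 := (hc1.rpow_const fun _ => Or.inr (zero_le_one.trans hp1.le)
      : Continuous fun y => max (hexWave i j k y) 0 ^ p.toReal).integrable_of_hasCompactSupport
      (μ := volume) (HasCompactSupport.of_compactSpace _)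
    have hi2 := (hc2.rpow_const fun _ => Or.inr (zero_le_one.trans hp1.le)
      : Continuous fun y => max (-hexWave i j k y) 0 ^ p.toReal).integrable_of_hasCompactSupport
      (μ := volume) (HasCompactSupport.of_compactSpace _)
    rw [integral_sub hi1 hi2, hint, sub_self] at hpos
    exact lt_irrefl _ hpos

/-- Multiplication by a nonzero integer preserves Haar measure on the torus, hence both norms. -/
lemma signRatio_comp_zsmul {f : UnitAddTorus (Fin d) → ℝ} (hf : Continuous f) {n : ℤ}
    (hn : n ≠ 0) (p : ℝ≥0∞) : signRatio (fun x => f (n • x)) p = signRatio f p := by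
  have hmp : MeasurePreserving (fun x : UnitAddTorus (Fin d) => n • x) volume volume :=
    Measure.measurePreserving_zsmul volume hn
  have h1 : Continuous fun y => max (f y) 0 := hf.max continuous_const
  have h2 : Continuous fun y => max (-f y) 0 := hf.neg.max continuous_const
  simp only [signRatio, positivePart_eq_max, negativePart_eq_max]
  rw [← eLpNorm_comp_measurePreserving h1.aestronglyMeasurable hmp,
    ← eLpNorm_comp_measurePreserving h2.aestronglyMeasurable hmp]
  rfl

/-! ### Eigenvalues of the dilated hexagonal waves. -/

/-- The frequency vector `2 π n (e i - e j)`. -/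
noncomputable def freq (n : ℤ) (i j : Fin d) : EuclideanSpace ℝ (Fin d) :=
  (2 * Real.pi * n) • (EuclideanSpace.single i 1 - EuclideanSpace.single j 1)

lemma inner_freq (n : ℤ) (i j : Fin d) (x : EuclideanSpace ℝ (Fin d)) :
    inner ℝ (freq n i j) x = 2 * Real.pi * (n * (x i - x j)) := by
  simp [freq, inner_smul_left, inner_sub_left, EuclideanSpace.inner_single_left]
  ring

lemma norm_freq_sq (n : ℤ) {i j : Fin d} (hij : i ≠ j) :
    ‖freq n i j‖ ^ 2 = 8 * Real.pi ^ 2 * n ^ 2 := by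
  rw [← real_inner_self_eq_norm_sq, inner_freq]
  simp [freq, hij, hij.symm]
  ring

lemma torusLift_hexWave_zsmul (n : ℤ) :
    torusLift (fun x => hexWave i j k (n • x)) =
      (fun x => Real.cos (inner ℝ (freq n i k) x)) + (fun x => Real.cos (inner ℝ (freq n k j) x))
        + fun x => Real.cos (inner ℝ (freq n i j) x) := by
  ext x
  simp only [torusLift, hexWave, Pi.smul_apply, ← AddCircle.coe_zsmul, ← AddCircle.coe_sub,
    circleCos_coe, Pi.add_apply, inner_freq, zsmul_eq_mul, mul_sub]

lemma isLaplaceEigenfunction_hexWave_zsmul (hij : i ≠ j) (hik : i ≠ k) (hjk : j ≠ k) (n : ℤ) :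
    IsLaplaceEigenfunction (fun x => hexWave i j k (n • x)) (8 * Real.pi ^ 2 * n ^ 2) where
  smooth := by
    rw [torusLift_hexWave_zsmul]
    exact ((contDiff_cos_inner _).add (contDiff_cos_inner _)).add (contDiff_cos_inner _)
  ne_zero h := by
    have := congrFun h 0
    simp [hexWave_zero] at this
  eigen x := by
    have hw : ∀ ξ : EuclideanSpace ℝ (Fin d),
        ContDiffAt ℝ 2 (fun x => Real.cos (inner ℝ ξ x)) x := fun ξ =>
      (contDiff_cos_inner ξ).contDiffAt
    have hadd : ContDiffAt ℝ 2 ((fun x => Real.cos (inner ℝ (freq n i k) x))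
        + fun x => Real.cos (inner ℝ (freq n k j) x)) x := (hw _).add (hw _)
    rw [torusLift_hexWave_zsmul, hadd.laplacian_add (hw _), (hw _).laplacian_add (hw _)]
    simp only [laplacian_cos_inner, norm_freq_sq n hij, norm_freq_sq n hik,
      norm_freq_sq n hjk.symm, Pi.add_apply]
    ring

end HexagonalWave

theorem mainTheorem1 (d : ℕ) (hd : 3 ≤ d) :
    ∃ (ψ : ℕ → UnitAddTorus (Fin d) → ℝ) (lam : ℕ → ℝ),
      (∀ n, 0 < lam n ∧ IsLaplaceEigenfunction (ψ n) (lam n)) ∧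
      Tendsto lam atTop atTop ∧
      ∀ p : ℝ≥0∞, 1 < p → ¬ Tendsto (fun n => signRatio (ψ n) p) atTop (nhds 1) := by
  let i : Fin d := ⟨0, by omega⟩
  let j : Fin d := ⟨1, by omega⟩
  let k : Fin d := ⟨2, by omega⟩
  have hij : i ≠ j := by simp [i, j]
  have hik : i ≠ k := by simp [i, k]
  have hjk : j ≠ k := by simp [j, k]
  -- Dilating by n + 1 keeps the factor nonzero, so the eigenvalue is positive and the dilation
  -- preserves measure.
  refine ⟨fun n x => hexWave i j k (((n + 1 : ℕ) : ℤ) • x),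
    fun n => 8 * Real.pi ^ 2 * (((n + 1 : ℕ) : ℤ) : ℝ) ^ 2,
    fun n => ⟨?_, isLaplaceEigenfunction_hexWave_zsmul i j k hij hik hjk _⟩, ?_, ?_⟩
  · push_cast
    have := Real.pi_pos
    positivity
  · refine Tendsto.const_mul_atTop (by have := Real.pi_pos; positivity) ?_
    refine (tendsto_pow_atTop two_ne_zero).comp ?_
    simp only [Int.cast_natCast]
    exact (tendsto_natCast_atTop_atTop (R := ℝ)).comp (tendsto_add_atTop_nat 1)
  · intro p hp h
    have hconst : (fun n : ℕ => signRatio (fun x => hexWave i j k (((n + 1 : ℕ) : ℤ) • x)) p)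
        = fun _ => signRatio (hexWave i j k) p :=
      funext fun n => signRatio_comp_zsmul (continuous_hexWave i j k) (by positivity) p
    rw [hconst] at h
    exact signRatio_hexWave_ne_one i j k hij hik hjk hp
      (tendsto_nhds_unique tendsto_const_nhds h)
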